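/- Let $0<q<1$, $\alpha<0$, and let $n\ge 2$ be an integer. Let $(a;q)_k=\prod_{j=0}^{k-1}(1-aq^j)$, $(a;q)_\infty=\prod_{j\ge 0}(1-aq^j)$, let $$(\mathcal D_q f)(x)=\frac{f(qx)-f(x)}{(q-1)x}\quad(x\neq 0),\qquad (\mathcal D_q f)(0)=f'(0),$$ and let $\langle \mathbf u,f\rangle=\int_0^\infty f(x)\,\frac{dx}{(-x;q)_\infty(-q/x;q)_\infty}$. Let $$S_k(x;q)=(-1)^kq^{-k^2}\,{}_1\phi_1(q^{-k};0;q,-q^{k+1}x)=(-1)^kq^{-k^2}\sum_{m\ge 0}\frac{(q^{-k};q)_m}{(q;q)_m}(-1)^mq^{\binom m2}(-q^{k+1}x)^m$$ be the monic Stieltjes–Wigert polynomials, and put $$\mathcal K_{q,n}^{(i,j)}(x,y)=\sum_{k=0}^{n-1}\frac{(\mathcal D_q^iS_k)(x;q)\,(\mathcal D_q^jS_k)(y;q)}{\langle \mathbf u,S_k^2\rangle},\qquad N_0=N_0(\alpha,n,q)=\left(\frac{(\mathcal D_qS_n)(\alpha;q)}{S_n(0;q)}\,\mathcal K_{q,n}^{(0,1)}(0,\alpha)-\mathcal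 K_{q,n}^{(1,1)}(\alpha,\alpha)\right)^{-1}.$$ For $N\ge 0$ let $(S_k^{(\alpha)}(N;x;q))_{k\ge 0}$ be the (uniquely determined) sequence of monic polynomials, $\deg S_k^{(\alpha)}=k$, orthogonal with respect to $$\langle f,g\rangle_S=\langle \mathbf u,fg\rangle+N\,(\mathcal D_qf)(\alpha)\,(\mathcal D_qg)(\alpha).$$ Then $N_0>0$ (in particular the inverse above exists), and for every $N\ge 0$ this sequence exists, all zeros of $S_n^{(\alpha)}(N;x;q)$ are real, and its smallest zero $\eta_{n,1}$ satisfies $$\eta_{n,1}>0\ \text{ if } N<N_0,\qquad \eta_{n,1}=0\ \text{ if } N=N_0,\qquad \eta_{n,1}<0\ \text{ if } N>N_0.$$ -/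

import Mathlib

open Polynomial

noncomputable section

namespace SWSobolev

/-- The Euler-Jackson `q`-derivative of a function of a real variable. -/
def qDeriv (q : ℝ) (f : ℝ → ℝ) (x : ℝ) : ℝ :=
  open Classical in
  if x ≠ 0 ∧ q ≠ 1 then (f (q * x) - f x) / ((q - 1) * x) else deriv f x

/-- The shifted factorial `(a; q)_n`. -/
def qPoch (a q : ℝ) (n : ℕ) : ℝ := ∏ j ∈ Finset.range n, (1 - a * q ^ j)

/-- The infinite shifted factorial `(a; q)_∞`. -/
def qPochInf (a q : ℝ) : ℝ := ∏' j : ℕ, (1 - a * q ^ j)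

/-- The basic hypergeometric series `_rφ_s (a₁, …, a_r; b₁, …, b_s; q, z)`. -/
def qHyp (a b : List ℝ) (q z : ℝ) : ℝ :=
  ∑' k : ℕ, (a.map fun t => qPoch t q k).prod / (b.map fun t => qPoch t q k).prod
    * ((-1) ^ k * q ^ (k.choose 2)) ^ (1 + (b.length : ℤ) - (a.length : ℤ))
    * (z ^ k / qPoch q q k)

/-- The monic Stieltjes-Wigert polynomial `S_n(x; q)`, as a function of `x`. -/
def swPoly (q : ℝ) (n : ℕ) (x : ℝ) : ℝ :=
  (-1) ^ n * q ^ (-((n : ℤ) ^ 2)) * qHyp [q ^ (-(n : ℤ))] [0] q (-(q ^ (n + 1) * x))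

/-- The Stieltjes-Wigert functional, integration over `(0, ∞)` against
`1 / (-x, -q/x; q)_∞`. -/
def swFunctional (q : ℝ) (f : ℝ → ℝ) : ℝ :=
  ∫ x in Set.Ioi (0 : ℝ), f x * (qPochInf (-x) q * qPochInf (-(q * x⁻¹)) q)⁻¹

/-- The Sobolev-type inner product with mass `N` at the point `α`. -/
def sobolevInner (q α N : ℝ) (f g : ℝ[X]) : ℝ :=
  swFunctional q (fun x => f.eval x * g.eval x)
    + N * qDeriv q (fun x => f.eval x) α * qDeriv q (fun x => g.eval x) α

/-- `p` is a monic orthogonal polynomial sequence for the bilinear form `B`. -/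
structure IsMOPS (B : ℝ[X] → ℝ[X] → ℝ) (p : ℕ → ℝ[X]) : Prop where
  monic : ∀ n, (p n).Monic
  natDegree_eq : ∀ n, (p n).natDegree = n
  orthogonal : ∀ m n, m ≠ n → B (p m) (p n) = 0
  norm_ne_zero : ∀ n, B (p n) (p n) ≠ 0

/-- The `q`-derivatives `K_{q,n}^{(i,j)}(x, y)` of the `n`-th reproducing kernel of the
Stieltjes-Wigert polynomials. -/
def swKernel (q : ℝ) (n i j : ℕ) (x y : ℝ) : ℝ :=
  ∑ k ∈ Finset.range n,
    (qDeriv q)^[i] (swPoly q k) x * (qDeriv q)^[j] (swPoly q k) y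
      / swFunctional q (fun t => swPoly q k t ^ 2)

/-- The critical mass `N₀(α, n, q)`. -/
def criticalMass (α : ℝ) (n : ℕ) (q : ℝ) : ℝ :=
  (qDeriv q (swPoly q n) α / swPoly q n 0 * swKernel q n 0 1 0 α - swKernel q n 1 1 α α)⁻¹

end SWSobolev

end

/-! Let `p` be the degree-`n` Sobolev polynomial. Polynomials `f` of degree below `n` with `(D_q
f)(α) = 0` do not see the mass, so `p` is orthogonal to them for `u` alone. Write `p = φ r`, with
`φ` collecting the positive roots. If `r` had degree at least 2, the test polynomial `φ (X - c)`,
with `c ≤ 0` chosen to kill the `q`-derivative at `α`, would give a product of constant sign on `(0,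
∞)` with zero integral. So `r` has degree at most 1: all zeros are real, at most one is nonpositive,
and the least zero has the sign of `(-1)^n p(0)` (`splits_and_exists_isLeast_root`).

The kernel formula for `p` gives `p(0) = S_n(0) (1 - N / N₀) / (1 + N K^{(1,1)}(α, α))`
(`eval_zero_sobolevPolynomial`), so only `N₀ > 0` remains. With `L_k = (D_q S_k)(α) / S_k(0)`, one
has `1 / N₀ = ∑_{k<n} S_k(0)² / ‖S_k‖² · L_k (L_n - L_k)`. Since `L_0 = 0` and `L_k` strictly
decreases (`strictAnti_swLogDeriv`), no term is negative (`criticalMass_pos`). -/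

namespace SWSobolev

open MeasureTheory Set

/-! ### The weight, its functional equation and its moments -/

section Weight

variable {q : ℝ}

lemma multipliable_qPochInf (hq0 : 0 < q) (hq1 : q < 1) (a : ℝ) :
    Multipliable fun j : ℕ => 1 - a * q ^ j := by
  simp_rw [sub_eq_add_neg]
  exact Real.multipliable_one_add_of_summable
    ((summable_geometric_of_lt_one hq0.le hq1).mul_left a).neg

lemma qPochInf_eq_mul (hq0 : 0 < q) (hq1 : q < 1) (a : ℝ) :
    qPochInf a q = (1 - a) * qPochInf (q * a) q := by
  have h := (multipliable_qPochInf hq0 hq1 (q * a))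
  have h' : ∀ j : ℕ, 1 - a * q ^ (j + 1) = 1 - q * a * q ^ j := fun j => by ring
  unfold qPochInf
  rw [tprod_eq_zero_mul' (f := fun j : ℕ => 1 - a * q ^ j) (by simpa only [h'] using h)]
  simp only [h', pow_zero, mul_one]

lemma qPoch_le_qPochInf (hq0 : 0 < q) (hq1 : q < 1) {a : ℝ} (ha : a ≤ 0) (n : ℕ) :
    qPoch a q n ≤ qPochInf a q := by
  have h1 : ∀ j : ℕ, 1 ≤ 1 - a * q ^ j := fun j => by
    nlinarith [mul_nonneg (neg_nonneg.2 ha) (pow_pos hq0 j).le]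
  have hmono : Monotone (qPoch a q) := monotone_nat_of_le_succ fun m => by
    unfold qPoch
    rw [Finset.prod_range_succ]
    exact le_mul_of_one_le_right
      (Finset.prod_nonneg fun j _ => zero_le_one.trans (h1 j)) (h1 m)
  refine ge_of_tendsto (multipliable_qPochInf hq0 hq1 a).hasProd.tendsto_prod_nat ?_
  filter_upwards [Filter.eventually_ge_atTop n] with m hm
  exact hmono hm

lemma one_le_qPochInf (hq0 : 0 < q) (hq1 : q < 1) {a : ℝ} (ha : a ≤ 0) :
    1 ≤ qPochInf a q := by
  simpa [qPoch] using qPoch_le_qPochInf hq0 hq1 ha 0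

lemma measurable_qPochInf (hq0 : 0 < q) (hq1 : q < 1) : Measurable fun a => qPochInf a q := by
  refine measurable_of_tendsto_metrizable
    (f := fun n a => ∏ j ∈ Finset.range n, (1 - a * q ^ j)) (fun n => by fun_prop) ?_
  exact tendsto_pi_nhds.2 fun a => (multipliable_qPochInf hq0 hq1 a).hasProd.tendsto_prod_nat

/-- The Stieltjes-Wigert weight `1 / (-x, -q/x; q)_∞`. -/
noncomputable def swWeight (q x : ℝ) : ℝ :=
  (qPochInf (-x) q * qPochInf (-(q * x⁻¹)) q)⁻¹

lemma measurable_swWeight (hq0 : 0 < q) (hq1 : q < 1) : Measurable (swWeight q) := by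
  have h := measurable_qPochInf hq0 hq1
  exact ((h.comp measurable_neg).mul
    (h.comp (measurable_inv.const_mul q).neg)).inv

lemma swWeight_pos (hq0 : 0 < q) (hq1 : q < 1) {x : ℝ} (hx : 0 < x) : 0 < swWeight q x := by
  have h1 := one_le_qPochInf hq0 hq1 (a := -x) (by linarith)
  have h2 := one_le_qPochInf hq0 hq1 (a := -(q * x⁻¹)) (by
    have := mul_pos hq0 (inv_pos.2 hx); linarith)
  unfold swWeight
  positivity

/-- Replacing `x` by `q x` removes the factor `1 + x` from one product and adds `1 + 1/x = (1 +
x)/x` to the other. -/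
lemma swWeight_mul (hq0 : 0 < q) (hq1 : q < 1) {x : ℝ} (hx : 0 < x) :
    swWeight q (q * x) = x * swWeight q x := by
  have h1 := qPochInf_eq_mul hq0 hq1 (-x)
  have h2 := qPochInf_eq_mul hq0 hq1 (-x⁻¹)
  have e1 : q * (q * x)⁻¹ = x⁻¹ := by field_simp
  unfold swWeight
  rw [e1, h1, h2, mul_neg, mul_neg]
  have e2 : (1 - -x⁻¹) = x⁻¹ * (1 - -x) := by field_simp; ring
  rw [e2]
  simp only [mul_inv, inv_inv]
  ring

/-- Since `1 + q^j x ≥ q^j (1 + x)`, the first `k + 2` factors of `(-x; q)_∞` already dominate a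
multiple of `(1 + x)^(k + 2)`. -/
lemma pow_mul_swWeight_le (hq0 : 0 < q) (hq1 : q < 1) (k : ℕ) :
    ∃ C : ℝ, 0 < C ∧ ∀ x : ℝ, 0 < x → x ^ k * swWeight q x ≤ C * (1 + x ^ 2)⁻¹ := by
  have hP : 0 < ∏ j ∈ Finset.range (k + 2), q ^ j := Finset.prod_pos fun j _ => pow_pos hq0 j
  refine ⟨(∏ j ∈ Finset.range (k + 2), q ^ j)⁻¹, inv_pos.2 hP, fun x hx => ?_⟩
  have h1 := qPoch_le_qPochInf hq0 hq1 (a := -x) (by linarith) (k + 2)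
  have h2 := one_le_qPochInf hq0 hq1 (a := -(q * x⁻¹)) (by
    have := mul_pos hq0 (inv_pos.2 hx); linarith)
  have h3 : (∏ j ∈ Finset.range (k + 2), q ^ j) * (1 + x) ^ (k + 2) ≤ qPoch (-x) q (k + 2) := by
    unfold qPoch
    have : (∏ j ∈ Finset.range (k + 2), q ^ j) * (1 + x) ^ (k + 2)
        = ∏ j ∈ Finset.range (k + 2), (q ^ j * (1 + x)) := by
      rw [Finset.prod_mul_distrib]; simp
    rw [this]
    refine Finset.prod_le_prod (fun j _ => by positivity) fun j _ => ?_
    have := pow_le_one₀ hq0.le hq1.le (n := j)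
    nlinarith
  have h4 : x ^ k * (1 + x ^ 2) ≤ (1 + x) ^ (k + 2) := by
    rw [pow_add]
    gcongr <;> nlinarith
  set P := ∏ j ∈ Finset.range (k + 2), q ^ j
  have h5 : P * (x ^ k * (1 + x ^ 2)) ≤ qPochInf (-x) q * qPochInf (-(q * x⁻¹)) q := by
    have : P * (x ^ k * (1 + x ^ 2)) ≤ P * (1 + x) ^ (k + 2) := by gcongr
    have h6 : 0 < qPochInf (-x) q := lt_of_lt_of_le (by positivity) (h3.trans h1)
    nlinarith
  have h7 : 0 < P * (x ^ k * (1 + x ^ 2)) := by positivity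
  unfold swWeight
  calc x ^ k * (qPochInf (-x) q * qPochInf (-(q * x⁻¹)) q)⁻¹
      ≤ x ^ k * (P * (x ^ k * (1 + x ^ 2)))⁻¹ := by gcongr
    _ = P⁻¹ * (1 + x ^ 2)⁻¹ := by field_simp

lemma integrableOn_pow_mul_swWeight (hq0 : 0 < q) (hq1 : q < 1) (k : ℕ) :
    IntegrableOn (fun x => x ^ k * swWeight q x) (Ioi 0) := by
  obtain ⟨C, hC, h⟩ := pow_mul_swWeight_le hq0 hq1 k
  refine Integrable.mono' (integrable_inv_one_add_sq.const_mul C).integrableOn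
    (((measurable_id.pow_const k).mul (measurable_swWeight hq0 hq1)).aestronglyMeasurable) ?_
  filter_upwards [ae_restrict_mem measurableSet_Ioi] with x hx
  have hx : 0 < x := hx
  have := swWeight_pos hq0 hq1 hx
  rw [Real.norm_of_nonneg (by positivity)]
  exact h x hx

lemma integrableOn_eval_mul_swWeight (hq0 : 0 < q) (hq1 : q < 1) (f : ℝ[X]) :
    IntegrableOn (fun x => f.eval x * swWeight q x) (Ioi 0) := by
  simp only [Polynomial.eval_eq_sum_range, Finset.sum_mul, mul_assoc]
  exact integrable_finsetSum _ fun i _ => (integrableOn_pow_mul_swWeight hq0 hq1 i).const_mul _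

/-- The Stieltjes-Wigert functional as a linear form on polynomials. -/
noncomputable def swLinear (hq0 : 0 < q) (hq1 : q < 1) : ℝ[X] →ₗ[ℝ] ℝ where
  toFun f := swFunctional q fun x => f.eval x
  map_add' f g := by
    have := integral_add (integrableOn_eval_mul_swWeight hq0 hq1 f)
      (integrableOn_eval_mul_swWeight hq0 hq1 g)
    simpa only [swFunctional, swWeight, eval_add, add_mul] using this
  map_smul' c f := by
    simpa only [swFunctional, eval_smul, smul_eq_mul, mul_assoc, swWeight, RingHom.id_apply]
      using integral_const_mul c fun x => f.eval x * swWeight q x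

lemma swLinear_apply (hq0 : 0 < q) (hq1 : q < 1) (f : ℝ[X]) :
    swLinear hq0 hq1 f = ∫ x in Ioi 0, f.eval x * swWeight q x := rfl

lemma swLinear_pos (hq0 : 0 < q) (hq1 : q < 1) {f : ℝ[X]} (hf : f ≠ 0)
    (hpos : ∀ x, 0 < x → 0 ≤ f.eval x) : 0 < swLinear hq0 hq1 f := by
  rw [swLinear_apply, setIntegral_pos_iff_support_of_nonneg_ae _
    (integrableOn_eval_mul_swWeight hq0 hq1 f)]
  · have hsub : Ioi (0 : ℝ) \ (f.roots.toFinset : Set ℝ)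
        ⊆ Function.support (fun x => f.eval x * swWeight q x) ∩ Ioi 0 := by
      rintro x ⟨hx, hr⟩
      refine ⟨?_, hx⟩
      have : f.eval x ≠ 0 := by simpa [hf] using hr
      exact mul_ne_zero this (swWeight_pos hq0 hq1 hx).ne'
    refine lt_of_lt_of_le ?_ (measure_mono hsub)
    rw [measure_sdiff_null (Finset.measure_zero _ _)]
    simp
  · filter_upwards [ae_restrict_mem measurableSet_Ioi] with x hx
    exact mul_nonneg (hpos x hx) (swWeight_pos hq0 hq1 hx).le

lemma swLinear_X_pow_succ (hq0 : 0 < q) (hq1 : q < 1) (k : ℕ) :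
    swLinear hq0 hq1 (X ^ (k + 1)) = (q ^ (k + 1))⁻¹ * swLinear hq0 hq1 (X ^ k) := by
  simp only [swLinear_apply, eval_pow, eval_X]
  have h := integral_comp_mul_left_Ioi (fun x => x ^ k * swWeight q x) 0 hq0
  rw [mul_zero, smul_eq_mul] at h
  have h2 : ∫ x in Ioi 0, (q * x) ^ k * swWeight q (q * x)
      = q ^ k * ∫ x in Ioi 0, x ^ (k + 1) * swWeight q x := by
    rw [← integral_const_mul]
    refine setIntegral_congr_fun measurableSet_Ioi fun x hx => ?_
    simp only [swWeight_mul hq0 hq1 hx]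
    ring
  rw [h2] at h
  have : q ^ k ≠ 0 := by positivity
  rw [pow_succ q k, mul_inv, mul_assoc, ← h]
  field_simp

lemma swLinear_X_pow (hq0 : 0 < q) (hq1 : q < 1) (k : ℕ) :
    swLinear hq0 hq1 (X ^ k) = (q ^ (k + 1).choose 2)⁻¹ * swLinear hq0 hq1 1 := by
  induction k with
  | zero => simp
  | succ k ih =>
    rw [swLinear_X_pow_succ, ih, Nat.choose_succ_succ (k + 1) 1, Nat.choose_one_right, pow_add,
      mul_inv]
    ring

end Weight

end SWSobolev

namespace SWSobolev

/-! ### Gaussian binomial coefficients -/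

section Gauss

/-- The Gaussian binomial coefficient. -/
def gaussBinom (q : ℝ) : ℕ → ℕ → ℝ
  | _, 0 => 1
  | 0, _ + 1 => 0
  | n + 1, m + 1 => gaussBinom q n m + q ^ (m + 1) * gaussBinom q n (m + 1)

variable {q : ℝ}

@[simp] lemma gaussBinom_zero_right (n : ℕ) : gaussBinom q n 0 = 1 := by
  cases n <;> rfl

lemma gaussBinom_succ_succ (n m : ℕ) : gaussBinom q (n + 1) (m + 1)
    = gaussBinom q n m + q ^ (m + 1) * gaussBinom q n (m + 1) := rfl

lemma gaussBinom_eq_zero_of_lt {n m : ℕ} (h : n < m) : gaussBinom q n m = 0 := by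
  induction n generalizing m with
  | zero => obtain ⟨m, rfl⟩ := Nat.exists_eq_succ_of_ne_zero h.ne'; rfl
  | succ n ih =>
    obtain ⟨m, rfl⟩ := Nat.exists_eq_succ_of_ne_zero (Nat.ne_zero_of_lt h)
    rw [Nat.succ_eq_add_one, gaussBinom_succ_succ, ih (by omega), ih (by omega)]
    simp

@[simp] lemma gaussBinom_self (n : ℕ) : gaussBinom q n n = 1 := by
  induction n with
  | zero => rfl
  | succ n ih => rw [gaussBinom_succ_succ, ih, gaussBinom_eq_zero_of_lt n.lt_succ_self]; simp

lemma gaussBinom_nonneg (hq0 : 0 < q) (n m : ℕ) : 0 ≤ gaussBinom q n m := by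
  induction n generalizing m with
  | zero => cases m <;> simp [gaussBinom]
  | succ n ih =>
    cases m with
    | zero => simp
    | succ m =>
      rw [gaussBinom_succ_succ]
      have := ih m
      have := ih (m + 1)
      positivity

/-- The ratio of consecutive coefficients is `(1 - q^(n-m)) / (1 - q^(m+1))`; multiplying through by
`q ^ m` avoids both division and the difference `n - m`. -/
lemma gaussBinom_succ_right (n m : ℕ) :
    q ^ m * (gaussBinom q n (m + 1) * (1 - q ^ (m + 1))) = gaussBinom q n m * (q ^ m - q ^ n) := by
  induction n generalizing m with
  | zero => cases m <;> simp [gaussBinom]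
  | succ n ih =>
    have h1 := ih m
    rw [gaussBinom_succ_succ]
    cases m with
    | zero => simp at h1 ⊢; linear_combination q * h1
    | succ m =>
      have h2 := ih m
      rw [gaussBinom_succ_succ n m]
      linear_combination q ^ (m + 2) * h1 + q * h2

lemma gaussBinom_succ_left (hq0 : 0 < q) (n m : ℕ) :
    gaussBinom q (n + 1) (m + 1) = gaussBinom q n (m + 1) + gaussBinom q n m * (q ^ n / q ^ m) := by
  have h := gaussBinom_succ_right (q := q) n m
  have : q ^ m ≠ 0 := by positivity
  rw [gaussBinom_succ_succ]
  field_simp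
  linear_combination -h

lemma gaussBinom_le_succ_left (hq0 : 0 < q) (n m : ℕ) :
    gaussBinom q n m ≤ gaussBinom q (n + 1) m := by
  cases m with
  | zero => simp
  | succ m =>
    rw [gaussBinom_succ_left hq0]
    have := gaussBinom_nonneg hq0 n m
    have : 0 ≤ gaussBinom q n m * (q ^ n / q ^ m) := by positivity
    linarith

lemma gaussBinom_one_lt_succ_left (hq0 : 0 < q) (n : ℕ) :
    gaussBinom q n 1 < gaussBinom q (n + 1) 1 := by
  rw [gaussBinom_succ_left hq0]
  have : 0 < gaussBinom q n 0 * (q ^ n / q ^ 0) := by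
    simp; positivity
  linarith

lemma qPoch_self_pos (hq0 : 0 < q) (hq1 : q < 1) (n : ℕ) : 0 < qPoch q q n := by
  refine Finset.prod_pos fun j _ => ?_
  rw [← pow_succ', sub_pos]
  exact pow_lt_one₀ hq0.le hq1 j.succ_ne_zero

lemma qPoch_succ (a : ℝ) (n : ℕ) : qPoch a q (n + 1) = qPoch a q n * (1 - a * q ^ n) :=
  Finset.prod_range_succ _ _

lemma qPoch_zpow_neg (hq0 : 0 < q) (n m : ℕ) :
    qPoch (q ^ (-(n : ℤ))) q m * q ^ (n * m)
      = (-1) ^ m * q ^ m.choose 2 * gaussBinom q n m * qPoch q q m := by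
  induction m with
  | zero => simp [qPoch]
  | succ m ih =>
    have h := gaussBinom_succ_right (q := q) n m
    rw [qPoch_succ, qPoch_succ, Nat.choose_succ_succ m 1, Nat.choose_one_right, mul_add n m 1,
      mul_one, zpow_neg, zpow_natCast, pow_add, pow_add]
    rw [zpow_neg, zpow_natCast] at ih
    have e : (1 - (q ^ n)⁻¹ * q ^ m) * q ^ n = q ^ n - q ^ m := by
      have : q ^ n ≠ 0 := by positivity
      field_simp
    calc _ = qPoch (q ^ n)⁻¹ q m * q ^ (n * m) * ((1 - (q ^ n)⁻¹ * q ^ m) * q ^ n) := by ring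
      _ = _ := by
        rw [ih, e]
        linear_combination ((-1) ^ m * q ^ m.choose 2 * qPoch q q m) * h

/-- The finite `q`-binomial theorem. -/
lemma sum_gaussBinom_mul_pow (n : ℕ) (z : ℝ) :
    ∑ m ∈ Finset.range (n + 1), gaussBinom q n m * (-1) ^ m * q ^ m.choose 2 * z ^ m
      = qPoch z q n := by
  induction n generalizing z with
  | zero => simp [qPoch]
  | succ n ih =>
    have h1 := ih (q * z)
    have h2 : qPoch z q (n + 1) = (1 - z) * qPoch (q * z) q n := by
      unfold qPoch
      rw [Finset.prod_range_succ', mul_comm]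
      simp [pow_succ', mul_assoc, mul_left_comm]
    -- The Pascal term carrying `q ^ m` is the sum at `q * z`; the other term, shifted by one,
    -- supplies `-z` times the same sum.
    have hs : ∑ m ∈ Finset.range (n + 2), q ^ m *
        (gaussBinom q n m * (-1) ^ m * q ^ m.choose 2 * z ^ m) = qPoch (q * z) q n := by
      rw [Finset.sum_range_succ, gaussBinom_eq_zero_of_lt n.lt_succ_self, ← h1]
      simp only [mul_pow]
      rw [add_eq_left.2 (by ring)]
      exact Finset.sum_congr rfl fun m _ => by ring
    rw [Finset.sum_range_succ'] at hs
    rw [Finset.sum_range_succ', h2, sub_mul, one_mul]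
    nth_rw 1 [← hs]
    rw [← h1, sub_eq_add_neg, add_right_comm, Finset.mul_sum, ← Finset.sum_neg_distrib,
      ← Finset.sum_add_distrib]
    congr 1
    · refine Finset.sum_congr rfl fun m _ => ?_
      rw [gaussBinom_succ_succ, Nat.choose_succ_succ m 1, Nat.choose_one_right]
      ring
    · simp

end Gauss

/-! ### Stieltjes-Wigert polynomials: closed form and orthogonality -/

section Polynomials

variable {q : ℝ}

/-- The normalising factor of the monic Stieltjes-Wigert polynomial, its value at `0`. -/
noncomputable def swScale (q : ℝ) (n : ℕ) : ℝ := (-1) ^ n * q ^ (-((n : ℤ) ^ 2))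

lemma swScale_ne_zero (hq0 : 0 < q) (n : ℕ) : swScale q n ≠ 0 :=
  mul_ne_zero (pow_ne_zero _ (by norm_num)) (zpow_ne_zero _ hq0.ne')

lemma neg_one_pow_mul_swScale_pos (hq0 : 0 < q) (n : ℕ) : 0 < (-1) ^ n * swScale q n := by
  rw [swScale, ← mul_assoc, ← mul_pow]
  simp only [mul_neg, mul_one, neg_neg, one_pow, one_mul]
  positivity

/-- The monic Stieltjes-Wigert polynomial as an element of `ℝ[X]`. -/
noncomputable def swPolynomial (q : ℝ) (n : ℕ) : ℝ[X] :=
  ∑ m ∈ Finset.range (n + 1),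
    (swScale q n * (gaussBinom q n m * q ^ (m ^ 2) * (-1) ^ m)) • X ^ m

lemma eval_swPolynomial (hq0 : 0 < q) (hq1 : q < 1) (n : ℕ) (x : ℝ) :
    (swPolynomial q n).eval x = swPoly q n x := by
  have hterm : ∀ m : ℕ, qPoch (q ^ (-(n : ℤ))) q m / qPoch 0 q m
      * ((-1) ^ m * q ^ m.choose 2) * ((-(q ^ (n + 1) * x)) ^ m / qPoch q q m)
      = gaussBinom q n m * q ^ (m ^ 2) * (-1) ^ m * x ^ m := by
    intro m
    have h0 : qPoch 0 q m = 1 := by simp [qPoch]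
    have h1 := qPoch_zpow_neg hq0 n m
    have h2 := (qPoch_self_pos hq0 hq1 m).ne'
    -- One `m.choose 2` comes from the series, one from `(q^(-n); q)_m`, and `m` is what remains of
    -- `(n + 1) m` once `q^(nm)` is absorbed.
    have h3 : m ^ 2 = m.choose 2 + m.choose 2 + m := by
      have h := Nat.choose_two_right m
      have e : m * (m - 1) / 2 * 2 = m * (m - 1) :=
        Nat.div_mul_cancel (Nat.even_mul_pred_self m).two_dvd
      rw [h]
      cases m with
      | zero => rfl
      | succ m => simp only [Nat.add_sub_cancel] at e ⊢; nlinarith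
    have h4 : ((-1 : ℝ) ^ m) * (-1) ^ m = 1 := by rw [← mul_pow]; simp
    rw [h0, h3, neg_pow (q ^ (n + 1) * x), mul_pow, ← pow_mul, Nat.succ_mul, pow_add q (n * m) m,
      pow_add, pow_add,
      div_one, mul_div_assoc', div_eq_iff h2]
    linear_combination ((-1) ^ m * (-1) ^ m * q ^ m.choose 2 * q ^ m * x ^ m) * h1
      + ((-1) ^ m * q ^ m.choose 2 * q ^ m.choose 2 * q ^ m * x ^ m * gaussBinom q n m
        * qPoch q q m) * h4
  have hsum : qHyp [q ^ (-(n : ℤ))] [0] q (-(q ^ (n + 1) * x))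
      = ∑ m ∈ Finset.range (n + 1), gaussBinom q n m * q ^ (m ^ 2) * (-1) ^ m * x ^ m := by
    unfold qHyp
    simp only [List.map_cons, List.map_nil, List.prod_cons, List.prod_nil, mul_one,
      List.length_cons, List.length_nil, zero_add, Nat.cast_one, add_sub_cancel_right, zpow_one,
      hterm]
    refine tsum_eq_sum fun m hm => ?_
    rw [gaussBinom_eq_zero_of_lt (by simpa using hm)]
    simp
  rw [swPoly, hsum, swPolynomial, eval_finsetSum, Finset.mul_sum]
  refine Finset.sum_congr rfl fun m _ => ?_
  simp only [eval_smul, eval_pow, eval_X, smul_eq_mul, swScale]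
  ring

lemma coeff_swPolynomial_self (hq0 : 0 < q) (n : ℕ) : (swPolynomial q n).coeff n = 1 := by
  simp only [swPolynomial, finsetSum_coeff, coeff_smul, coeff_X_pow, smul_eq_mul, mul_ite,
    mul_one, mul_zero]
  rw [Finset.sum_ite_eq, if_pos (by simp), swScale, gaussBinom_self]
  have h4 : ((-1 : ℝ) ^ n) * (-1) ^ n = 1 := by rw [← mul_pow]; simp
  have : q ^ (-(n : ℤ) ^ 2) * q ^ (n ^ 2) = 1 := by
    rw [zpow_neg, ← Nat.cast_pow, zpow_natCast]
    exact inv_mul_cancel₀ (by positivity)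
  linear_combination (q ^ (-(n : ℤ) ^ 2) * q ^ (n ^ 2)) * h4 + this

lemma natDegree_swPolynomial_le (n : ℕ) : (swPolynomial q n).natDegree ≤ n := by
  refine natDegree_sum_le_of_forall_le _ _ fun m hm => ?_
  refine (natDegree_smul_le _ _).trans ((natDegree_X_pow_le m).trans ?_)
  simpa [Nat.lt_succ_iff] using hm

lemma monic_swPolynomial (hq0 : 0 < q) (n : ℕ) : (swPolynomial q n).Monic :=
  monic_of_natDegree_le_of_coeff_eq_one n (natDegree_swPolynomial_le n)
    (coeff_swPolynomial_self hq0 n)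

lemma natDegree_swPolynomial (hq0 : 0 < q) (n : ℕ) : (swPolynomial q n).natDegree = n :=
  natDegree_eq_of_le_of_coeff_ne_zero (natDegree_swPolynomial_le n)
    (by rw [coeff_swPolynomial_self hq0]; exact one_ne_zero)

lemma eval_zero_swPolynomial (n : ℕ) : (swPolynomial q n).eval 0 = swScale q n := by
  rw [swPolynomial, eval_finsetSum, Finset.sum_range_succ']
  simp

/-- Inserting the moments turns the sum into the `q`-binomial expansion of `(z; q)_n` at `z =
q^(-k)`, whose factor of index `k < n` vanishes. -/
lemma swLinear_swPolynomial_mul_X_pow (hq0 : 0 < q) (hq1 : q < 1) {n k : ℕ} (hk : k < n) :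
    swLinear hq0 hq1 (swPolynomial q n * X ^ k) = 0 := by
  have hz : qPoch ((q ^ k)⁻¹) q n = 0 := by
    refine Finset.prod_eq_zero (Finset.mem_range.2 hk) ?_
    rw [inv_mul_cancel₀ (by positivity), sub_self]
  rw [swPolynomial, Finset.sum_mul, map_sum]
  have hterm : ∀ m : ℕ, swLinear hq0 hq1
      ((swScale q n * (gaussBinom q n m * q ^ (m ^ 2) * (-1) ^ m)) • X ^ m * X ^ k)
      = swScale q n * (q ^ (k + 1).choose 2)⁻¹ * swLinear hq0 hq1 1 *
        (gaussBinom q n m * (-1) ^ m * q ^ m.choose 2 * ((q ^ k)⁻¹) ^ m) := by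
    intro m
    rw [smul_mul_assoc, ← pow_add, map_smul, swLinear_X_pow, smul_eq_mul]
    have e : m ^ 2 + (k + 1).choose 2 + m * k = m.choose 2 + (m + k + 1).choose 2 := by
      have h : ∀ m : ℕ, (m + 1).choose 2 * 2 = (m + 1) * m := fun m => by
        rw [Nat.choose_two_right, Nat.add_sub_cancel]
        exact Nat.div_mul_cancel (by
          have := Nat.even_mul_succ_self m; rw [mul_comm]; exact this.two_dvd)
      have h1 := h k
      have h2 := h (m + k)
      have h3 : m.choose 2 + m = (m + 1).choose 2 := by
        rw [Nat.choose_succ_succ m 1, Nat.choose_one_right, add_comm]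
      have h4 := h m
      nlinarith
    have e' := congrArg (fun t => q ^ t) e
    simp only [pow_add _ (_ + _), pow_add _ (_ : ℕ) (Nat.choose _ _)] at e'
    have e2 : q ^ (m ^ 2) * (q ^ (m + k + 1).choose 2)⁻¹
        = (q ^ (k + 1).choose 2)⁻¹ * (q ^ m.choose 2 * ((q ^ k)⁻¹) ^ m) := by
      rw [inv_pow, ← pow_mul, mul_comm k m]
      field_simp
      linear_combination e'
    linear_combination (swScale q n * gaussBinom q n m * (-1) ^ m * swLinear hq0 hq1 1) * e2
  rw [Finset.sum_congr rfl fun m _ => hterm m, ← Finset.mul_sum, sum_gaussBinom_mul_pow, hz,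
    mul_zero]

lemma swLinear_swPolynomial_mul (hq0 : 0 < q) (hq1 : q < 1) {n : ℕ} {f : ℝ[X]}
    (hf : f.degree < n) : swLinear hq0 hq1 (swPolynomial q n * f) = 0 := by
  rw [as_sum_range_C_mul_X_pow f, Finset.mul_sum, map_sum]
  refine Finset.sum_eq_zero fun k _ => ?_
  rw [mul_left_comm, ← smul_eq_C_mul, map_smul]
  by_cases hk : k < n
  · rw [swLinear_swPolynomial_mul_X_pow hq0 hq1 hk, smul_zero]
  · rw [coeff_eq_zero_of_degree_lt (hf.trans_le (by exact_mod_cast not_lt.1 hk)), zero_smul]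

end Polynomials

end SWSobolev

namespace SWSobolev

/-! ### The `q`-derivative at a negative point -/

section QDerivative

variable {q α : ℝ}

/-- The value at `α` of the `q`-derivative, as a linear form on polynomials. -/
noncomputable def qDerivLinear (q α : ℝ) : ℝ[X] →ₗ[ℝ] ℝ :=
  ((q - 1) * α)⁻¹ • (leval (q * α) - leval α)

lemma qDerivLinear_apply (f : ℝ[X]) :
    qDerivLinear q α f = ((q - 1) * α)⁻¹ * (f.eval (q * α) - f.eval α) := rfl

lemma qDeriv_eval (hq1 : q < 1) (hα : α < 0) (f : ℝ[X]) :
    qDeriv q (fun x => f.eval x) α = qDerivLinear q α f := by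
  rw [qDeriv, if_pos ⟨hα.ne, hq1.ne⟩, qDerivLinear_apply, div_eq_inv_mul]

lemma neg_one_pow_mul_qDerivLinear_X_pow (m : ℕ) :
    (-1) ^ m * qDerivLinear q α (X ^ m) = (-α) ^ m * (1 - q ^ m) / ((1 - q) * α) := by
  rw [qDerivLinear_apply, neg_pow α, div_eq_inv_mul, ← neg_sub q 1, neg_mul, inv_neg]
  simp only [eval_pow, eval_X, mul_pow]
  ring

lemma neg_one_pow_mul_qDerivLinear_X_pow_neg (hq0 : 0 < q) (hq1 : q < 1) (hα : α < 0)
    {m : ℕ} (hm : m ≠ 0) : (-1) ^ m * qDerivLinear q α (X ^ m) < 0 := by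
  rw [neg_one_pow_mul_qDerivLinear_X_pow]
  refine div_neg_of_pos_of_neg (mul_pos (pow_pos (by linarith) m) ?_)
    (mul_neg_of_pos_of_neg (by linarith) hα)
  exact sub_pos.2 (pow_lt_one₀ hq0.le hq1 hm)

/-- The quotient of the `q`-derivative at `α` and the value at `0` of `S_k(x; q)`. -/
noncomputable def swLogDeriv (q α : ℝ) (k : ℕ) : ℝ :=
  ∑ m ∈ Finset.range (k + 1),
    gaussBinom q k m * q ^ (m ^ 2) * ((-1) ^ m * qDerivLinear q α (X ^ m))

lemma qDerivLinear_swPolynomial (k : ℕ) :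
    qDerivLinear q α (swPolynomial q k) = swScale q k * swLogDeriv q α k := by
  rw [swPolynomial, map_sum, swLogDeriv, Finset.mul_sum]
  refine Finset.sum_congr rfl fun m _ => ?_
  rw [map_smul, smul_eq_mul]
  ring

lemma swLogDeriv_zero : swLogDeriv q α 0 = 0 := by
  simp [swLogDeriv, qDerivLinear_apply]

/-- The Gaussian binomials grow with `k` and multiply quantities that are negative for `m ≥ 1` and
zero for `m = 0`; the `m = 1` term makes the decrease strict. -/
lemma strictAnti_swLogDeriv (hq0 : 0 < q) (hq1 : q < 1) (hα : α < 0) :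
    StrictAnti (swLogDeriv q α) := by
  refine strictAnti_nat_of_succ_lt fun k => ?_
  have h : swLogDeriv q α k = ∑ m ∈ Finset.range (k + 2),
      gaussBinom q k m * q ^ (m ^ 2) * ((-1) ^ m * qDerivLinear q α (X ^ m)) := by
    rw [Finset.sum_range_succ _ (k + 1), gaussBinom_eq_zero_of_lt k.lt_succ_self]
    simp [swLogDeriv]
  rw [h, swLogDeriv]
  refine Finset.sum_lt_sum (fun m _ => ?_) ⟨1, by simp, ?_⟩
  · rcases eq_or_ne m 0 with rfl | hm
    · simp [qDerivLinear_apply]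
    · refine mul_le_mul_of_nonpos_right ?_
        (neg_one_pow_mul_qDerivLinear_X_pow_neg hq0 hq1 hα hm).le
      have := gaussBinom_le_succ_left hq0 k m
      gcongr
  · refine mul_lt_mul_of_neg_right ?_
      (neg_one_pow_mul_qDerivLinear_X_pow_neg hq0 hq1 hα one_ne_zero)
    have := gaussBinom_one_lt_succ_left hq0 k
    gcongr

end QDerivative

/-! ### Location of the zeros -/

section Zeros

lemma forall_pos_or_forall_neg_of_forall_ne_zero {r : ℝ[X]} (hr : ∀ x, 0 < x → r.eval x ≠ 0) :
    (∀ x, 0 < x → 0 < r.eval x) ∨ ∀ x, 0 < x → r.eval x < 0 := by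
  by_contra! h
  obtain ⟨⟨a, ha, ha'⟩, b, hb, hb'⟩ := h
  obtain ⟨x, hx, hx'⟩ := isPreconnected_Ioi.intermediate_value (s := Set.Ioi (0 : ℝ)) ha hb
    r.continuous.continuousOn ⟨ha', hb'⟩
  exact hr x hx hx'

lemma swLinear_ne_zero {q : ℝ} (hq0 : 0 < q) (hq1 : q < 1) {f g : ℝ[X]} (hf : f ≠ 0)
    (hg : g ≠ 0) (hf' : ∀ x, 0 < x → f.eval x ≠ 0) (hg' : ∀ x, 0 < x → 0 ≤ g.eval x) :
    swLinear hq0 hq1 (f * g) ≠ 0 := by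
  rcases forall_pos_or_forall_neg_of_forall_ne_zero hf' with h | h
  · refine (swLinear_pos hq0 hq1 (mul_ne_zero hf hg) fun x hx => ?_).ne'
    rw [eval_mul]
    exact mul_nonneg (h x hx).le (hg' x hx)
  · have := swLinear_pos hq0 hq1 (neg_ne_zero.2 (mul_ne_zero hf hg)) fun x hx => by
      rw [eval_neg, eval_mul]
      linarith [mul_nonpos_of_nonpos_of_nonneg (h x hx).le (hg' x hx)]
    rw [map_neg] at this
    linarith

/-- Here `t` is the product of the ratios `(x - b) / (x - a)`, each in `(0, 1)`. It is used with `a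
= α`, `b = q α`. -/
lemma exists_eval_prod_X_sub_C_eq_mul (T : Multiset ℝ) (hT : ∀ x ∈ T, 0 < x) {a b : ℝ}
    (hab : a < b) (hb : b ≤ 0) :
    ∃ t : ℝ, 0 < t ∧ t ≤ 1 ∧ (T ≠ 0 → t < 1) ∧
      (T.map fun x => X - C x).prod.eval b = t * (T.map fun x => X - C x).prod.eval a := by
  induction T using Multiset.induction with
  | empty => exact ⟨1, by simp⟩
  | cons x T ih =>
    obtain ⟨t, h0, h1, -, h⟩ := ih fun y hy => hT y (Multiset.mem_cons_of_mem hy)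
    have hx : 0 < x := hT x (Multiset.mem_cons_self x T)
    have hs0 : 0 < (x - b) / (x - a) := div_pos (by linarith) (by linarith)
    have hs1 : (x - b) / (x - a) < 1 := (div_lt_one (by linarith)).2 (by linarith)
    have hlt : (x - b) / (x - a) * t < 1 := by nlinarith
    refine ⟨(x - b) / (x - a) * t, by positivity, hlt.le, fun _ => hlt, ?_⟩
    have : x - a ≠ 0 := by linarith
    simp only [Multiset.map_cons, Multiset.prod_cons, eval_mul, h, eval_sub, eval_X, eval_C]
    field_simp
    ring

lemma neg_one_pow_card_mul_eval_prod_X_sub_C_pos (T : Multiset ℝ) (hT : ∀ x ∈ T, 0 < x) :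
    0 < (-1) ^ T.card * (T.map fun x => X - C x).prod.eval 0 := by
  induction T using Multiset.induction with
  | empty => simp
  | cons x T ih =>
    have h := ih fun y hy => hT y (Multiset.mem_cons_of_mem hy)
    have hx : 0 < x := hT x (Multiset.mem_cons_self x T)
    simp only [Multiset.map_cons, Multiset.prod_cons, eval_mul, eval_sub, eval_X, eval_C,
      Multiset.card_cons, pow_succ]
    nlinarith

lemma exists_prod_X_sub_C_mul_eq {p : ℝ[X]} (hp : p.Monic) :
    ∃ (T : Multiset ℝ) (r : ℝ[X]), (∀ x ∈ T, 0 < x) ∧ r.Monic ∧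
      (∀ x, 0 < x → r.eval x ≠ 0) ∧ p = (T.map fun x => X - C x).prod * r := by
  set T := p.roots.filter (0 < ·) with hT
  obtain ⟨r, hr⟩ := (Multiset.prod_X_sub_C_dvd_iff_le_roots hp.ne_zero T).2
    (Multiset.filter_le _ _)
  have hφ : (T.map fun x => X - C x).prod.Monic := monic_multiset_prod_of_monic _ _
    fun x _ => monic_X_sub_C x
  have hrm : r.Monic := hφ.of_mul_monic_left (hr ▸ hp)
  refine ⟨T, r, fun x hx => (Multiset.mem_filter.1 hx).2, hrm, fun x hx hrx => ?_, hr⟩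
  have h1 : p.roots = T + r.roots := by
    conv_lhs => rw [hr]
    rw [roots_mul (hr ▸ hp.ne_zero), roots_multiset_prod_X_sub_C]
  -- All positive roots of `p` are in `T`, so cancelling `T` leaves no positive root for `r`.
  have h2 : T = T + r.roots.filter (0 < ·) := by
    conv_lhs => rw [hT, h1, Multiset.filter_add]
    congr 1
    exact Multiset.filter_eq_self.2 fun y hy => (Multiset.mem_filter.1 hy).2
  have h3 : r.roots.filter (0 < ·) = 0 := by simpa using h2
  have : x ∈ r.roots.filter (0 < ·) :=
    Multiset.mem_filter.2 ⟨(mem_roots hrm.ne_zero).2 hrx, hx⟩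
  simp [h3] at this

variable {q α : ℝ}

lemma natDegree_cofactor_le_one (hq0 : 0 < q) (hq1 : q < 1) (hα : α < 0) {n : ℕ}
    {p r : ℝ[X]} {T : Multiset ℝ} (hT : ∀ x ∈ T, 0 < x) (hr : r.Monic)
    (hr' : ∀ x, 0 < x → r.eval x ≠ 0) (hpr : p = (T.map fun x => X - C x).prod * r)
    (hn : T.card + r.natDegree = n)
    (horth : ∀ f : ℝ[X], f.degree < n → qDerivLinear q α f = 0 →
      swLinear hq0 hq1 (p * f) = 0) : r.natDegree ≤ 1 := by
  by_contra! hd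
  -- Without positive roots `t = 1` and `c` below is unavailable; the constant `1` serves as test
  -- polynomial.
  rcases eq_or_ne T 0 with rfl | hT0
  · have h1 := horth 1 (by rw [degree_one]; exact_mod_cast (by omega : 0 < n))
      (by simp [qDerivLinear_apply])
    rw [hpr, Multiset.map_zero, Multiset.prod_zero, one_mul] at h1
    exact swLinear_ne_zero hq0 hq1 hr.ne_zero one_ne_zero hr' (fun x _ => by simp) h1
  · set φ := (T.map fun x => X - C x).prod with hφdef
    have hφ : φ.Monic := monic_multiset_prod_of_monic _ _ fun x _ => monic_X_sub_C x
    obtain ⟨t, -, -, ht1, ht⟩ := exists_eval_prod_X_sub_C_eq_mul T hT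
      (a := α) (b := q * α) (by nlinarith) (by nlinarith)
    rw [← hφdef] at ht
    replace ht1 := ht1 hT0
    -- This `c` solves `t (q α - c) = α - c`, which says that `φ (X - c)` takes equal values at `q
    -- α` and `α`.
    obtain ⟨c, hc⟩ : ∃ c, c = α * (1 - q * t) / (1 - t) := ⟨_, rfl⟩
    have hcneg : c ≤ 0 := by
      rw [hc]
      refine div_nonpos_of_nonpos_of_nonneg (mul_nonpos_of_nonpos_of_nonneg hα.le ?_)
        (by linarith)
      nlinarith
    have hceq : c * (1 - t) = α * (1 - q * t) := by
      rw [hc, div_mul_cancel₀ _ (by linarith)]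
    have hdeg : (φ * (X - C c)).degree < (n : WithBot ℕ) := by
      rw [degree_eq_natDegree (hφ.mul (monic_X_sub_C c)).ne_zero,
        hφ.natDegree_mul (monic_X_sub_C c), natDegree_X_sub_C, hφdef,
        natDegree_multiset_prod_X_sub_C_eq_card]
      exact_mod_cast (by omega)
    have hD : qDerivLinear q α (φ * (X - C c)) = 0 := by
      rw [qDerivLinear_apply]
      simp only [eval_mul, ht, eval_sub, eval_X, eval_C]
      linear_combination (((q - 1) * α)⁻¹ * φ.eval α) * hceq
    have h1 := horth _ hdeg hD
    rw [hpr, show φ * r * (φ * (X - C c)) = r * (φ * φ * (X - C c)) by ring] at h1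
    refine swLinear_ne_zero hq0 hq1 hr.ne_zero
      ((hφ.mul hφ).mul (monic_X_sub_C c)).ne_zero hr' (fun x hx => ?_) h1
    simp only [eval_mul, eval_sub, eval_X, eval_C]
    exact mul_nonneg (mul_self_nonneg _) (by linarith)

/-- A monic polynomial of degree `n ≥ 2` that is orthogonal to all polynomials of lower degree
whose `q`-derivative at `α < 0` vanishes has only real zeros, and the sign of the least one is
that of `(-1) ^ n p(0)`. -/
lemma splits_and_exists_isLeast_root (hq0 : 0 < q) (hq1 : q < 1) (hα : α < 0) {n : ℕ}
    (hn : 2 ≤ n) {p : ℝ[X]} (hp : p.Monic) (hpn : p.natDegree = n)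
    (horth : ∀ f : ℝ[X], f.degree < n → qDerivLinear q α f = 0 →
      swLinear hq0 hq1 (p * f) = 0) :
    p.Splits ∧ ∃ η : ℝ, IsLeast {x : ℝ | p.IsRoot x} η ∧
      ∃ c : ℝ, 0 < c ∧ (-1) ^ n * p.eval 0 = c * η := by
  obtain ⟨T, r, hT, hr, hr', hpr⟩ := exists_prod_X_sub_C_mul_eq hp
  have hφ : (T.map fun x => X - C x).prod.Monic := monic_multiset_prod_of_monic _ _
    fun x _ => monic_X_sub_C x
  have hcard : T.card + r.natDegree = n := by
    rw [← hpn, hpr, hφ.natDegree_mul hr, natDegree_multiset_prod_X_sub_C_eq_card]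
  have hle := natDegree_cofactor_le_one hq0 hq1 hα hT hr hr' hpr hcard horth
  have hφs : (T.map fun x => X - C x).prod.Splits := Splits.multisetProd fun f hf => by
    obtain ⟨x, -, rfl⟩ := Multiset.mem_map.1 hf
    exact Splits.X_sub_C x
  have hφr : ∀ x, (T.map fun x => X - C x).prod.IsRoot x ↔ x ∈ T := fun x => by
    rw [← mem_roots hφ.ne_zero, roots_multiset_prod_X_sub_C]
  have hpos := neg_one_pow_card_mul_eval_prod_X_sub_C_pos T hT
  rcases Nat.le_one_iff_eq_zero_or_eq_one.1 hle with h0 | h1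
  -- Here `r = 1` and every root is positive; `n ≥ 2` ensures that there is one.
  · rw [hr.natDegree_eq_zero.1 h0, mul_one] at hpr
    have hne : T.toFinset.Nonempty := by
      rw [Multiset.toFinset_nonempty, ← Multiset.card_pos]
      omega
    have hleast := T.toFinset.isLeast_min' hne
    set η := T.toFinset.min' hne
    have hη : 0 < η := hT η (by simpa using hleast.1)
    refine ⟨hpr ▸ hφs, η, ?_, _, div_pos hpos hη, ?_⟩
    · have hset : {x : ℝ | p.IsRoot x} = (T.toFinset : Set ℝ) := by
        ext x
        rw [Set.mem_ofPred_eq, hpr, hφr, Finset.mem_coe, Multiset.mem_toFinset]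
      rwa [hset]
    · rw [div_mul_cancel₀ _ hη.ne', hpr, ← hcard, h0, add_zero]
  -- Here `r = X + a` with `a ≥ 0`, so `-a` lies below all of `T` and `c = (-1)^|T| φ(0)`.
  · have hrX := hr.eq_X_add_C h1
    set a := r.coeff 0
    have ha : 0 ≤ a := by
      by_contra! h
      exact hr' (-a) (by linarith) (by rw [hrX]; simp)
    refine ⟨?_, -a, ⟨?_, fun x hx => ?_⟩, _, hpos, ?_⟩
    · rw [hpr, hrX]
      exact hφs.mul (Splits.X_add_C a)
    · simp [hpr, hrX]
    · rw [Set.mem_ofPred_eq, hpr, root_mul, hφr] at hx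
      rcases hx with hx | hx
      · linarith [hT x hx]
      · rw [hrX] at hx
        simp at hx
        linarith
    · rw [hpr, ← hcard, h1, pow_succ, eval_mul, hrX]
      simp
      ring

end Zeros

/-! ### Sobolev orthogonality and uniqueness -/

section Orthogonality

/-- Monic polynomials of each degree form a basis. Applied to the Sobolev form and to the
reproducing property of the kernel. -/
lemma eq_zero_of_forall_monic_eq_zero {p : ℕ → ℝ[X]} (hp : ∀ n, (p n).Monic)
    (hdeg : ∀ n, (p n).natDegree = n) (Λ : ℝ[X] →ₗ[ℝ] ℝ) {n : ℕ} (hΛ : ∀ k < n, Λ (p k) = 0)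
    {f : ℝ[X]} (hf : f.degree < n) : Λ f = 0 := by
  induction n generalizing f with
  | zero =>
    have : f = 0 := degree_eq_bot.1 (Nat.WithBot.lt_zero_iff.1 (by exact_mod_cast hf))
    rw [this, map_zero]
  | succ n ih =>
    have h : (f - f.coeff n • p n).degree < n := by
      rw [degree_lt_iff_coeff_zero]
      intro m hm
      rcases hm.eq_or_lt with rfl | hm
      · have : (p n).coeff n = 1 := by
          have := (hp n).coeff_natDegree
          rwa [hdeg] at this
        simp [this]
      · rw [coeff_sub, coeff_smul, coeff_eq_zero_of_natDegree_lt (p := p n) (by rwa [hdeg]),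
          coeff_eq_zero_of_degree_lt (hf.trans_le (by exact_mod_cast hm))]
        simp
    have h' := ih (fun k hk => hΛ k (by omega)) h
    rwa [map_sub, map_smul, hΛ n n.lt_succ_self, smul_zero, sub_zero] at h'

variable {q α N : ℝ}

lemma sobolevInner_eq (hq0 : 0 < q) (hq1 : q < 1) (hα : α < 0) (f g : ℝ[X]) :
    sobolevInner q α N f g = swLinear hq0 hq1 (f * g)
      + N * qDerivLinear q α f * qDerivLinear q α g := by
  rw [sobolevInner, qDeriv_eval hq1 hα, qDeriv_eval hq1 hα]
  simp_rw [← eval_mul]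
  rfl

lemma sobolevInner_comm (f g : ℝ[X]) : sobolevInner q α N f g = sobolevInner q α N g f := by
  simp only [sobolevInner, mul_comm (f.eval _), mul_right_comm]

lemma sobolevInner_self_pos (hq0 : 0 < q) (hq1 : q < 1) (hα : α < 0) (hN : 0 ≤ N) {f : ℝ[X]}
    (hf : f ≠ 0) : 0 < sobolevInner q α N f f := by
  rw [sobolevInner_eq hq0 hq1 hα, mul_assoc]
  have h1 := swLinear_pos hq0 hq1 (mul_ne_zero hf hf) fun x _ => by
    rw [eval_mul]; exact mul_self_nonneg _
  have h2 := mul_nonneg hN (mul_self_nonneg (qDerivLinear q α f))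
  linarith

lemma IsMOPS.sobolevInner_eq_zero (hq0 : 0 < q) (hq1 : q < 1) (hα : α < 0) {s : ℕ → ℝ[X]}
    (hs : IsMOPS (sobolevInner q α N) s) {n : ℕ} {f : ℝ[X]} (hf : f.degree < n) :
    sobolevInner q α N (s n) f = 0 := by
  have h := eq_zero_of_forall_monic_eq_zero hs.monic hs.natDegree_eq
    (swLinear hq0 hq1 ∘ₗ LinearMap.mulLeft ℝ (s n)
      + (N * qDerivLinear q α (s n)) • qDerivLinear q α) (n := n) (fun k hk => ?_) hf
  · simpa [sobolevInner_eq hq0 hq1 hα] using h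
  · simpa [sobolevInner_eq hq0 hq1 hα] using hs.orthogonal n k hk.ne'

/-- The difference of two candidates has degree below `n`, so it is orthogonal to both, hence to
itself; positivity forces it to vanish. -/
lemma isMOPS_sobolevInner_unique (hq0 : 0 < q) (hq1 : q < 1) (hα : α < 0) (hN : 0 ≤ N)
    {s t : ℕ → ℝ[X]} (hs : IsMOPS (sobolevInner q α N) s)
    (ht : IsMOPS (sobolevInner q α N) t) : s = t := by
  funext n
  by_contra hne
  have hd : (s n - t n).degree < n := by
    have h := degree_sub_lt_left (p := s n) (q := t n)
      (by rw [degree_eq_natDegree (hs.monic n).ne_zero, degree_eq_natDegree (ht.monic n).ne_zero,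
        hs.natDegree_eq, ht.natDegree_eq]) (hs.monic n).ne_zero
      (by rw [(hs.monic n).leadingCoeff, (ht.monic n).leadingCoeff])
    rwa [degree_eq_natDegree (hs.monic n).ne_zero, hs.natDegree_eq] at h
  have h1 := hs.sobolevInner_eq_zero hq0 hq1 hα hd
  have h2 := ht.sobolevInner_eq_zero hq0 hq1 hα hd
  have h3 := sobolevInner_self_pos hq0 hq1 hα hN (sub_ne_zero.2 hne)
  rw [sobolevInner_eq hq0 hq1 hα] at h1 h2 h3
  simp only [sub_mul, map_sub] at h1 h2 h3
  linarith

lemma isMOPS_of_forall_degree_lt (hq0 : 0 < q) (hq1 : q < 1) (hα : α < 0) (hN : 0 ≤ N)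
    {s : ℕ → ℝ[X]} (hm : ∀ n, (s n).Monic) (hd : ∀ n, (s n).natDegree = n)
    (ho : ∀ (n : ℕ) (f : ℝ[X]), f.degree < n → sobolevInner q α N (s n) f = 0) :
    IsMOPS (sobolevInner q α N) s where
  monic := hm
  natDegree_eq := hd
  orthogonal m n hmn := by
    have hdeg : ∀ k, (s k).degree = k := fun k => by
      rw [degree_eq_natDegree (hm k).ne_zero, hd]
    rcases hmn.lt_or_gt with h | h
    · rw [sobolevInner_comm]
      exact ho n _ (by rw [hdeg]; exact_mod_cast h)
    · exact ho m _ (by rw [hdeg]; exact_mod_cast h)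
  norm_ne_zero n := (sobolevInner_self_pos hq0 hq1 hα hN (hm n).ne_zero).ne'

end Orthogonality

/-! ### Kernel polynomials, existence and the critical mass -/

section Kernel

variable {q α N : ℝ}

/-- The squared norm of `S_k(x; q)`. -/
noncomputable def swNormSq (hq0 : 0 < q) (hq1 : q < 1) (k : ℕ) : ℝ :=
  swLinear hq0 hq1 (swPolynomial q k * swPolynomial q k)

lemma swNormSq_pos (hq0 : 0 < q) (hq1 : q < 1) (k : ℕ) : 0 < swNormSq hq0 hq1 k :=
  swLinear_pos hq0 hq1 (((monic_swPolynomial hq0 k).mul (monic_swPolynomial hq0 k)).ne_zero)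
    fun x _ => by rw [eval_mul]; exact mul_self_nonneg _

lemma degree_swPolynomial (hq0 : 0 < q) (k : ℕ) : (swPolynomial q k).degree = k := by
  rw [degree_eq_natDegree (monic_swPolynomial hq0 k).ne_zero, natDegree_swPolynomial hq0]

lemma swLinear_swPolynomial_mul_swPolynomial (hq0 : 0 < q) (hq1 : q < 1) {j k : ℕ}
    (h : j ≠ k) : swLinear hq0 hq1 (swPolynomial q j * swPolynomial q k) = 0 := by
  rcases h.lt_or_gt with h | h
  · rw [mul_comm]
    exact swLinear_swPolynomial_mul hq0 hq1
      (by rw [degree_swPolynomial hq0]; exact_mod_cast h)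
  · exact swLinear_swPolynomial_mul hq0 hq1
      (by rw [degree_swPolynomial hq0]; exact_mod_cast h)

/-- The kernel polynomial `K_{q,n}^{(0,1)}(x, α)`. -/
noncomputable def swKernelPolynomial (hq0 : 0 < q) (hq1 : q < 1) (α : ℝ) (n : ℕ) : ℝ[X] :=
  ∑ k ∈ Finset.range n,
    (qDerivLinear q α (swPolynomial q k) / swNormSq hq0 hq1 k) • swPolynomial q k

lemma degree_swKernelPolynomial_lt (hq0 : 0 < q) (hq1 : q < 1) (n : ℕ) :
    (swKernelPolynomial hq0 hq1 α n).degree < n := by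
  rw [← mem_degreeLT]
  refine Submodule.sum_mem _ fun k hk => Submodule.smul_mem _ _ ?_
  rw [mem_degreeLT, degree_swPolynomial hq0]
  exact_mod_cast Finset.mem_range.1 hk

/-- The reproducing property of the kernel. -/
lemma swLinear_swKernelPolynomial_mul (hq0 : 0 < q) (hq1 : q < 1) {n : ℕ} {f : ℝ[X]}
    (hf : f.degree < n) :
    swLinear hq0 hq1 (swKernelPolynomial hq0 hq1 α n * f) = qDerivLinear q α f := by
  have h := eq_zero_of_forall_monic_eq_zero (monic_swPolynomial hq0)
    (natDegree_swPolynomial hq0)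
    (swLinear hq0 hq1 ∘ₗ LinearMap.mulLeft ℝ (swKernelPolynomial hq0 hq1 α n)
      - qDerivLinear q α) (n := n) (fun j hj => ?_) hf
  · simpa [sub_eq_zero] using h
  · simp only [LinearMap.sub_apply, LinearMap.comp_apply, LinearMap.mulLeft_apply, sub_eq_zero]
    rw [swKernelPolynomial, Finset.sum_mul, map_sum,
      Finset.sum_eq_single_of_mem j (Finset.mem_range.2 hj) fun k _ hkj => by
        rw [smul_mul_assoc, map_smul, swLinear_swPolynomial_mul_swPolynomial hq0 hq1 hkj,
          smul_zero]]
    rw [smul_mul_assoc, map_smul, smul_eq_mul]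
    exact div_mul_cancel₀ _ (swNormSq_pos hq0 hq1 j).ne'

lemma qDerivLinear_swKernelPolynomial_nonneg (hq0 : 0 < q) (hq1 : q < 1) (n : ℕ) :
    0 ≤ qDerivLinear q α (swKernelPolynomial hq0 hq1 α n) := by
  rw [swKernelPolynomial, map_sum]
  refine Finset.sum_nonneg fun k _ => ?_
  rw [map_smul, smul_eq_mul, div_mul_eq_mul_div]
  exact div_nonneg (mul_self_nonneg _) (swNormSq_pos hq0 hq1 k).le

/-- The monic Sobolev-type orthogonal polynomial, in terms of the kernel polynomial. -/
noncomputable def sobolevPolynomial (hq0 : 0 < q) (hq1 : q < 1) (α N : ℝ) (n : ℕ) : ℝ[X] :=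
  swPolynomial q n - (N * qDerivLinear q α (swPolynomial q n)
    / (1 + N * qDerivLinear q α (swKernelPolynomial hq0 hq1 α n)))
      • swKernelPolynomial hq0 hq1 α n

/-- Against `f` of degree below `n`, `S_n` pairs to zero under `u` and the kernel pairs to `(D_q
f)(α)`; its coefficient is exactly what cancels the mass term. -/
lemma isMOPS_sobolevPolynomial (hq0 : 0 < q) (hq1 : q < 1) (hα : α < 0) (hN : 0 ≤ N) :
    IsMOPS (sobolevInner q α N) (sobolevPolynomial hq0 hq1 α N) := by
  have hlt : ∀ (n : ℕ) (c : ℝ),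
      (c • swKernelPolynomial hq0 hq1 α n).degree < (swPolynomial q n).degree := fun n c => by
    rw [degree_swPolynomial hq0]
    exact (degree_smul_le _ _).trans_lt (degree_swKernelPolynomial_lt hq0 hq1 n)
  refine isMOPS_of_forall_degree_lt hq0 hq1 hα hN
    (fun n => (monic_swPolynomial hq0 n).sub_of_left (hlt n _)) (fun n => ?_)
    fun n f hf => ?_
  · refine natDegree_eq_of_degree_eq_some ?_
    rw [sobolevPolynomial, degree_sub_eq_left_of_degree_lt (hlt n _), degree_swPolynomial hq0]
  · have hK := mul_nonneg hN (qDerivLinear_swKernelPolynomial_nonneg (α := α) hq0 hq1 n)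
    have hK' : 1 + N * qDerivLinear q α (swKernelPolynomial hq0 hq1 α n) ≠ 0 := by linarith
    rw [sobolevInner_eq hq0 hq1 hα, sobolevPolynomial, sub_mul, map_sub,
      swLinear_swPolynomial_mul hq0 hq1 hf, smul_mul_assoc, map_smul,
      swLinear_swKernelPolynomial_mul hq0 hq1 hf, map_sub, map_smul, smul_eq_mul, smul_eq_mul]
    field_simp
    ring

lemma swPoly_eq (hq0 : 0 < q) (hq1 : q < 1) (k : ℕ) :
    swPoly q k = fun x => (swPolynomial q k).eval x :=
  funext fun x => (eval_swPolynomial hq0 hq1 k x).symm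

lemma swFunctional_swPoly_sq (hq0 : 0 < q) (hq1 : q < 1) (k : ℕ) :
    swFunctional q (fun t => swPoly q k t ^ 2) = swNormSq hq0 hq1 k := by
  simp_rw [swPoly_eq hq0 hq1, sq, ← eval_mul]
  rfl

lemma swKernel_zero_one (hq0 : 0 < q) (hq1 : q < 1) (hα : α < 0) (n : ℕ) (x : ℝ) :
    swKernel q n 0 1 x α = (swKernelPolynomial hq0 hq1 α n).eval x := by
  rw [swKernel, swKernelPolynomial, eval_finsetSum]
  refine Finset.sum_congr rfl fun k _ => ?_
  rw [swFunctional_swPoly_sq hq0 hq1, swPoly_eq hq0 hq1, Function.iterate_zero_apply,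
    Function.iterate_one, qDeriv_eval hq1 hα, eval_smul, smul_eq_mul]
  ring

lemma swKernel_one_one (hq0 : 0 < q) (hq1 : q < 1) (hα : α < 0) (n : ℕ) :
    swKernel q n 1 1 α α = qDerivLinear q α (swKernelPolynomial hq0 hq1 α n) := by
  rw [swKernel, swKernelPolynomial, map_sum]
  refine Finset.sum_congr rfl fun k _ => ?_
  rw [swFunctional_swPoly_sq hq0 hq1, swPoly_eq hq0 hq1, Function.iterate_one,
    qDeriv_eval hq1 hα, map_smul, smul_eq_mul]
  ring

lemma criticalMass_eq (hq0 : 0 < q) (hq1 : q < 1) (hα : α < 0) (n : ℕ) :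
    criticalMass α n q = (swLogDeriv q α n * (swKernelPolynomial hq0 hq1 α n).eval 0
      - qDerivLinear q α (swKernelPolynomial hq0 hq1 α n))⁻¹ := by
  rw [criticalMass, swKernel_zero_one hq0 hq1 hα, swKernel_one_one hq0 hq1 hα,
    swPoly_eq hq0 hq1, qDeriv_eval hq1 hα, qDerivLinear_swPolynomial]
  beta_reduce
  rw [eval_zero_swPolynomial, mul_div_cancel_left₀ _ (swScale_ne_zero hq0 n)]

lemma criticalMass_pos (hq0 : 0 < q) (hq1 : q < 1) (hα : α < 0) {n : ℕ} (hn : 2 ≤ n) :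
    0 < criticalMass α n q := by
  rw [criticalMass_eq hq0 hq1 hα, inv_pos, swKernelPolynomial, eval_finsetSum, map_sum,
    Finset.mul_sum, ← Finset.sum_sub_distrib]
  have hanti := strictAnti_swLogDeriv hq0 hq1 hα
  have hterm : ∀ k, swLogDeriv q α n * eval 0
        ((qDerivLinear q α (swPolynomial q k) / swNormSq hq0 hq1 k) • swPolynomial q k)
      - qDerivLinear q α
        ((qDerivLinear q α (swPolynomial q k) / swNormSq hq0 hq1 k) • swPolynomial q k)
      = swScale q k ^ 2 / swNormSq hq0 hq1 k *
        (swLogDeriv q α k * (swLogDeriv q α n - swLogDeriv q α k)) := fun k => by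
    rw [eval_smul, map_smul, smul_eq_mul, smul_eq_mul, qDerivLinear_swPolynomial,
      eval_zero_swPolynomial]
    ring
  have hc : ∀ k, 0 < swScale q k ^ 2 / swNormSq hq0 hq1 k := fun k =>
    div_pos (sq_pos_of_ne_zero (swScale_ne_zero hq0 k)) (swNormSq_pos hq0 hq1 k)
  simp only [hterm]
  -- The `k = 0` term is zero because `L_0 = 0`; the strictly positive term is `k = 1`, present
  -- since `n ≥ 2`.
  refine Finset.sum_pos' (fun k hk => ?_) ⟨1, Finset.mem_range.2 (by omega), ?_⟩
  · refine mul_nonneg (hc k).le (mul_nonneg_of_nonpos_of_nonpos ?_ ?_)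
    · rw [← swLogDeriv_zero (q := q) (α := α)]
      exact hanti.antitone k.zero_le
    · exact sub_nonpos.2 (hanti (Finset.mem_range.1 hk)).le
  · refine mul_pos (hc 1) (mul_pos_of_neg_of_neg ?_ (sub_neg.2 (hanti (by omega))))
    rw [← swLogDeriv_zero (q := q) (α := α)]
    exact hanti one_pos

lemma eval_zero_sobolevPolynomial (hq0 : 0 < q) (hq1 : q < 1) (hα : α < 0) (hN : 0 ≤ N)
    (n : ℕ) : (sobolevPolynomial hq0 hq1 α N n).eval 0
      = swScale q n / (1 + N * qDerivLinear q α (swKernelPolynomial hq0 hq1 α n))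
        * (1 - N * (criticalMass α n q)⁻¹) := by
  have hK := mul_nonneg hN (qDerivLinear_swKernelPolynomial_nonneg (α := α) hq0 hq1 n)
  have hK' : 1 + N * qDerivLinear q α (swKernelPolynomial hq0 hq1 α n) ≠ 0 := by linarith
  rw [criticalMass_eq hq0 hq1 hα, inv_inv, sobolevPolynomial, eval_sub, eval_smul, smul_eq_mul,
    eval_zero_swPolynomial, qDerivLinear_swPolynomial]
  field_simp
  ring

end Kernel

end SWSobolev

/-! ### The sign of the least zero -/

open SWSobolev in
theorem corollary3 (q : ℝ) (hq0 : 0 < q) (hq1 : q < 1) (α : ℝ) (hα : α < 0)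
    (n : ℕ) (hn : 2 ≤ n) :
    0 < SWSobolev.criticalMass α n q ∧
    ∀ N : ℝ, 0 ≤ N →
      (∃! s : ℕ → Polynomial ℝ, SWSobolev.IsMOPS (SWSobolev.sobolevInner q α N) s) ∧
      ∀ s : ℕ → Polynomial ℝ, SWSobolev.IsMOPS (SWSobolev.sobolevInner q α N) s →
        (s n).Splits ∧
        ∃ η : ℝ, IsLeast {x : ℝ | (s n).IsRoot x} η ∧
          (N < SWSobolev.criticalMass α n q → 0 < η) ∧
          (N = SWSobolev.criticalMass α n q → η = 0) ∧
          (SWSobolev.criticalMass α n q < N → η < 0) := by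
  have hM := criticalMass_pos hq0 hq1 hα hn
  refine ⟨hM, fun N hN => ⟨⟨_, isMOPS_sobolevPolynomial hq0 hq1 hα hN, fun t ht =>
    isMOPS_sobolevInner_unique hq0 hq1 hα hN ht (isMOPS_sobolevPolynomial hq0 hq1 hα hN)⟩,
    fun s hs => ?_⟩⟩
  obtain ⟨hsplit, η, hη, c, hc, hcη⟩ := splits_and_exists_isLeast_root hq0 hq1 hα hn
    (hs.monic n) (hs.natDegree_eq n) fun f hf hDf => by
      have h := hs.sobolevInner_eq_zero hq0 hq1 hα hf
      rwa [sobolevInner_eq hq0 hq1 hα, hDf, mul_zero, add_zero] at h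
  refine ⟨hsplit, η, hη, ?_⟩
  -- By uniqueness, `(-1)^n p(0)` is both `c * η` and a positive multiple of `1 - N / N₀`.
  rw [isMOPS_sobolevInner_unique hq0 hq1 hα hN hs (isMOPS_sobolevPolynomial hq0 hq1 hα hN),
    eval_zero_sobolevPolynomial hq0 hq1 hα hN, ← mul_assoc, ← mul_div_assoc] at hcη
  have hK := mul_nonneg hN (qDerivLinear_swKernelPolynomial_nonneg (α := α) hq0 hq1 n)
  have hd : 0 < (-1) ^ n * swScale q n
      / (1 + N * qDerivLinear q α (swKernelPolynomial hq0 hq1 α n)) :=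
    div_pos (neg_one_pow_mul_swScale_pos hq0 n) (by linarith)
  rw [← div_eq_mul_inv] at hcη
  refine ⟨fun h => ?_, fun h => ?_, fun h => ?_⟩
  · have h1 : 0 < 1 - N / criticalMass α n q := sub_pos.2 ((div_lt_one hM).2 h)
    exact pos_of_mul_pos_right (hcη ▸ mul_pos hd h1) hc.le
  · rw [h, div_self hM.ne', sub_self, mul_zero] at hcη
    exact (mul_eq_zero.1 hcη.symm).resolve_left hc.ne'
  · have h1 : 1 - N / criticalMass α n q < 0 := sub_neg.2 ((one_lt_div hM).2 h)
    exact neg_of_mul_neg_right (hcη ▸ mul_neg_of_pos_of_neg hd h1) hc.le
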